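/- All graphs are finite, undirected and simple. In a connected graph $M$ with distance $d$ let $I(u,v)=\{x\in V(M) : d(u,v)=d(u,x)+d(x,v)\}$; $M$ is \emph{median} if it is connected and $|I(u,v)\cap I(v,w)\cap I(w,u)|=1$ for all vertices $u,v,w$, and a set $S\subseteq V(M)$ is \emph{convex} if $I(u,v)\subseteq S$ for all $u,v\in S$. For an edge $ab$ of $M$ let $W_{ab}=\{v : d(v,a)<d(v,b)\}$ and let $U_{ab}$ be the set of vertices of $W_{ab}$ that have a neighbour in $W_{ba}$. A \emph{median decomposition} of a graph $G$ is a pair $(M,(X_a)_{a\in V(M)})$ of a median graph $M$ and sets $X_a\subseteq V(G)$ such that (M1) for every edge $uv$ of $G$ there is $a\in V(M)$ with $u,v\in X_a$, and (M2) for every $v\in V(G)$ the set $X^{-1}(v)=\{a\in V(M) : v\in X_a\}$ is non-empty and convex in $M$. Its \emph{width} is $\max_{a\in V(M)}|X_a|$. Put $Z_{ab}=\bigcup_{x\in U_{ab}}X_x$. The decomposition is \emph{$\Theta$-smooth} if (M3) for every edge $ab$ of $M$ we have $|Z_{ab}\setminus Z_{ba}|=|Z_{ba}\setminus Z_{ab}|=1$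 and, writing $Z_{ab}\setminus Z_{ba}=\{v_a\}$ and $Z_{ba}\setminus Z_{ab}=\{v_b\}$, the set $X^{-1}(v_a)\cup X^{-1}(v_b)$ is convex in $M$. The \emph{smooth medianwidth} $\mathrm{smw}(G)$ is the minimum width of a $\Theta$-smooth median decomposition of $G$. \textbf{Theorem.} For every graph $G$, the minimum defining $\mathrm{smw}(G)$ is attained (in particular $G$ has a $\Theta$-smooth median decomposition), and $\mathrm{smw}(G)=\chi(G)$, the chromatic number of $G$. -/

import Mathlib

namespace SimpleGraph

section Median

variable {M : Type*} (T : SimpleGraph M)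

/-- The interval `I(u, v)`: all vertices lying on a shortest path from `u` to `v`
(used for connected graphs). -/
def geodInterval (u v : M) : Set M :=
  {x | T.dist u v = T.dist u x + T.dist x v}

/-- A graph is median if it is connected and every three vertices have a unique median. -/
structure IsMedian : Prop where
  connected : T.Connected
  existsUnique_median : ∀ u v w : M,
    ∃! x, x ∈ T.geodInterval u v ∩ T.geodInterval v w ∩ T.geodInterval w u

/-- (Geodesically) convex sets of vertices. -/
def IsGeodConvex (S : Set M) : Prop :=
  ∀ u ∈ S, ∀ v ∈ S, T.geodInterval u v ⊆ S

/-- `W_{ab}`: the vertices strictly closer to `a` than to `b`. -/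
def wSet (a b : M) : Set M :=
  {v | T.dist v a < T.dist v b}

/-- `U_{ab}`: the vertices of `W_{ab}` that have a neighbour in `W_{ba}`. -/
def uSet (a b : M) : Set M :=
  {v | v ∈ T.wSet a b ∧ ∃ w ∈ T.wSet b a, T.Adj v w}

end Median

/-- A median decomposition of `G` with underlying median graph `T`:
a family of bags indexed by the vertices of `T` that satisfies (M1) and (M2). -/
structure MedianDecomposition {V M : Type*} (G : SimpleGraph V) (T : SimpleGraph M) where
  isMedian : T.IsMedian
  bag : M → Set V
  /-- (M1): both ends of each edge of `G` lie in a common bag. -/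
  exists_bag_of_adj : ∀ u v : V, G.Adj u v → ∃ a, u ∈ bag a ∧ v ∈ bag a
  /-- (M2), first half: every vertex of `G` lies in some bag. -/
  exists_bag : ∀ v : V, {a | v ∈ bag a}.Nonempty
  /-- (M2), second half: the bags containing a given vertex of `G` form a convex set of `T`. -/
  convex_bags : ∀ v : V, T.IsGeodConvex {a | v ∈ bag a}

namespace MedianDecomposition

variable {V M : Type*} {G : SimpleGraph V} {T : SimpleGraph M} (D : MedianDecomposition G T)

/-- `X⁻¹(v)`: the vertices of `T` whose bag contains `v`. -/
def support (v : V) : Set M :=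
  {a | v ∈ D.bag a}

/-- `Z_{ab}`: the union of the bags over `U_{ab}`. -/
def zSet (a b : M) : Set V :=
  ⋃ x ∈ T.uSet a b, D.bag x

/-- (M3), `Θ`-smoothness: for every edge `ab` of `T`, each of `Z_{ab} \ Z_{ba}` and
`Z_{ba} \ Z_{ab}` has exactly one element, `v_a` and `v_b` respectively, and
`X⁻¹(v_a) ∪ X⁻¹(v_b)` is convex in `T`. -/
def IsThetaSmooth : Prop :=
  ∀ a b : M, T.Adj a b → ∃ va vb : V,
    D.zSet a b \ D.zSet b a = {va} ∧ D.zSet b a \ D.zSet a b = {vb} ∧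
      T.IsGeodConvex (D.support va ∪ D.support vb)

/-- The width: the largest size of a bag. -/
noncomputable def width [Fintype M] : ℕ :=
  Finset.univ.sup fun a => (D.bag a).ncard

end MedianDecomposition

/-- The widths of the `Θ`-smooth median decompositions of `G` over finite median graphs. Every
finite graph is isomorphic to one whose vertices form a type in the lowest universe. -/
def smoothWidths {V : Type*} (G : SimpleGraph V) : Set ℕ∞ :=
  {k | ∃ (M : Type) (_ : Fintype M) (T : SimpleGraph M) (D : MedianDecomposition G T),
    D.IsThetaSmooth ∧ (D.width : ℕ∞) = k}

/-- The smooth medianwidth of `G`: the least width of a `Θ`-smooth median decomposition. -/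
noncomputable def smoothMedianwidth {V : Type*} (G : SimpleGraph V) : ℕ∞ :=
  sInf G.smoothWidths

end SimpleGraph

/-! Lower bound: in a `Θ`-smooth decomposition, crossing an edge of the median graph exchanges
exactly one vertex of the bag for another (`IsThetaSmooth.bag_diff`), and opposite edges of a
four-cycle make the same exchange. Fix a root `r`, colour `X_r` by the identity, and give each other
`p` the colour of the vertex that replaces it on the first step towards `r` from the bag of `p`
closest to `r`. Squares carry this rule to every edge (`IsThetaSmooth.eq_of_exchange`), so the
colouring is injective on every bag; by (M1) it is proper, with at most `|X_r|` colours.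

Upper bound: given a colouring with all classes non-empty, order each class as a path. The Cartesian
product of these paths is median, and its vertices are the transversals of the classes; these are
the bags. -/

namespace SimpleGraph

/-! ### Median graphs: squares and half-spaces -/

section Median

variable {M : Type*} {T : SimpleGraph M}

theorem mem_geodInterval {u v x : M} :
    x ∈ T.geodInterval u v ↔ T.dist u v = T.dist u x + T.dist x v := Iff.rfl

namespace IsMedian

theorem exists_median (hT : T.IsMedian) (u v w : M) : ∃ x,
    T.dist u v = T.dist u x + T.dist x v ∧ T.dist v w = T.dist v x + T.dist x w ∧
      T.dist w u = T.dist w x + T.dist x u := by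
  obtain ⟨x, ⟨⟨h1, h2⟩, h3⟩, -⟩ := hT.existsUnique_median u v w
  exact ⟨x, h1, h2, h3⟩

/-- The median of `a`, `b`, `v` is `a` or `b`, and that end is nearer to `v`; so median graphs are
bipartite. -/
theorem dist_ne_of_adj (hT : T.IsMedian) {a b : M} (h : T.Adj a b) (v : M) :
    T.dist v a ≠ T.dist v b := by
  intro heq
  obtain ⟨x, h1, h2, h3⟩ := hT.exists_median a b v
  rw [dist_eq_one_iff_adj.mpr h] at h1
  have := T.dist_comm (u := v) (v := b)
  have := T.dist_comm (u := v) (v := a)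
  have := T.dist_comm (u := b) (v := x)
  have := T.dist_comm (u := a) (v := x)
  have := T.dist_comm (u := v) (v := x)
  omega

theorem dist_adj_cases (hT : T.IsMedian) {a b : M} (h : T.Adj a b) (v : M) :
    T.dist v a + 1 = T.dist v b ∨ T.dist v b + 1 = T.dist v a := by
  have h1 := hT.dist_ne_of_adj h v
  have h2 := hT.connected.dist_triangle (u := v) (v := a) (w := b)
  have h3 := hT.connected.dist_triangle (u := v) (v := b) (w := a)
  have h4 := dist_eq_one_iff_adj.mpr h
  have h5 := dist_eq_one_iff_adj.mpr h.symm
  omega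

theorem mem_geodInterval_of_mem_wSet (hT : T.IsMedian) {a b w : M} (h : T.Adj a b)
    (hw : w ∈ T.wSet b a) : b ∈ T.geodInterval a w := by
  have h1 : T.dist w b < T.dist w a := hw
  have h2 := hT.dist_adj_cases h w
  have h3 := dist_eq_one_iff_adj.mpr h
  rw [mem_geodInterval, T.dist_comm (u := a) (v := w), T.dist_comm (u := b) (v := w)]
  omega

/-- The first step of a shortest path. -/
theorem exists_adj_dist_add_one (hT : T.IsMedian) {a w : M} (h : a ≠ w) :
    ∃ b, T.Adj a b ∧ T.dist b w + 1 = T.dist a w := by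
  obtain ⟨p, hp⟩ := (hT.connected a w).exists_walk_length_eq_dist
  cases p with
  | nil => exact absurd rfl h
  | @cons _ b _ hab q =>
    refine ⟨b, hab, ?_⟩
    have h1 := T.dist_le q
    have h2 := hT.dist_adj_cases hab w
    rw [T.dist_comm (u := w), T.dist_comm (u := w)] at h2
    simp only [Walk.length_cons] at hp
    omega

/-- The median of `x`, `y`, `r` works: it is equidistant from `x` and `y`, which forces `d(x, y) =
2`. -/
theorem quadrangle (hT : T.IsMedian) {u x y r : M} (hx : T.Adj u x) (hy : T.Adj u y)
    (hxy : x ≠ y) (hxr : T.dist x r + 1 = T.dist u r) (hyr : T.dist y r + 1 = T.dist u r) :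
    ∃ z, T.Adj x z ∧ T.Adj y z ∧ T.dist z r + 2 = T.dist u r := by
  obtain ⟨z, h1, h2, h3⟩ := hT.exists_median x y r
  have h4 : T.dist x y ≠ 0 := by
    rw [hT.connected.dist_eq_zero_iff.ne]; exact hxy
  have h5 := hT.connected.dist_triangle (u := x) (v := u) (w := y)
  have h6 := dist_eq_one_iff_adj.mpr hx.symm
  have h7 := dist_eq_one_iff_adj.mpr hy
  have h8 := T.dist_comm (u := x) (v := z)
  have h9 := T.dist_comm (u := y) (v := z)
  have h10 := T.dist_comm (u := r) (v := z)
  have h11 := T.dist_comm (u := r) (v := x)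
  refine ⟨z, dist_eq_one_iff_adj.mp ?_, dist_eq_one_iff_adj.mp ?_, ?_⟩ <;> omega

/-- Opposite edges of a four-cycle define the same half-spaces (one inclusion). -/
theorem wSet_subset_of_square (hT : T.IsMedian) {x x' y y' : M} (hxy : T.Adj x y)
    (hxx : T.Adj x x') (hyy : T.Adj y y') (hxy' : T.Adj x' y') (hne : x ≠ y') (hne' : x' ≠ y) :
    T.wSet x y ⊆ T.wSet x' y' := by
  intro v hv
  have hv' : T.dist v x < T.dist v y := hv
  by_contra hcon
  have hcon' : ¬ T.dist v x' < T.dist v y' := hcon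
  have h1 := hT.dist_adj_cases hxy v
  have h2 := hT.dist_adj_cases hxx v
  have h3 := hT.dist_adj_cases hyy v
  have h4 := hT.dist_adj_cases hxy' v
  have e1 := dist_eq_one_iff_adj.mpr hxy
  have e2 := dist_eq_one_iff_adj.mpr hxx
  have e3 := dist_eq_one_iff_adj.mpr hyy
  have e4 := dist_eq_one_iff_adj.mpr hxy'
  have e5 : T.dist x' y = 2 := by
    have := hT.connected.dist_triangle (u := x') (v := x) (w := y)
    have : T.dist x' y ≠ 0 := by rw [hT.connected.dist_eq_zero_iff.ne]; exact hne'
    have : T.dist x' y ≠ T.dist x' x := (hT.dist_ne_of_adj hxy x').symm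
    have := T.dist_comm (u := x) (v := x')
    omega
  -- Here `x` and `y'` are equally far from `v`, with `x'` and `y` one step further, so both are
  -- medians of `x'`, `y`, `v`.
  refine hne ((hT.existsUnique_median x' y v).unique ?_ ?_) <;>
  · simp only [Set.mem_inter_iff, mem_geodInterval]
    have := T.dist_comm (u := v) (v := x)
    have := T.dist_comm (u := v) (v := y)
    have := T.dist_comm (u := v) (v := y')
    have := T.dist_comm (u := x) (v := x')
    have := T.dist_comm (u := x) (v := y)
    have := T.dist_comm (u := x') (v := y')
    have := T.dist_comm (u := y) (v := y')
    omega

theorem wSet_eq_of_square (hT : T.IsMedian) {x x' y y' : M} (hxy : T.Adj x y)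
    (hxx : T.Adj x x') (hyy : T.Adj y y') (hxy' : T.Adj x' y') (hne : x ≠ y') (hne' : x' ≠ y) :
    T.wSet x y = T.wSet x' y' :=
  (hT.wSet_subset_of_square hxy hxx hyy hxy' hne hne').antisymm
    (hT.wSet_subset_of_square hxy' hxx.symm hyy.symm hxy hne' hne)

/-- An edge `x y` crossing from `W_{ab}` to `W_{ba}` with `x ≠ a` is opposite, in a four-cycle, to
such an edge which is closer to `a b`. -/
theorem exists_square (hT : T.IsMedian) {a b x y : M} (hab : T.Adj a b) (hxy : T.Adj x y)
    (hx : x ∈ T.wSet a b) (hy : y ∈ T.wSet b a) (hxa : x ≠ a) :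
    ∃ x' y', T.Adj x x' ∧ T.Adj y y' ∧ T.Adj x' y' ∧ x ≠ y' ∧ x' ≠ y ∧ x' ∈ T.wSet a b ∧
      y' ∈ T.wSet b a ∧ T.dist x' a + 1 = T.dist x a := by
  obtain ⟨x', hxx, hd⟩ := hT.exists_adj_dist_add_one hxa
  have hx' : T.dist x a < T.dist x b := hx
  have hy' : T.dist y b < T.dist y a := hy
  have h1 := hT.dist_adj_cases hab x
  have h2 := hT.dist_adj_cases hab y
  have h3 := hT.dist_adj_cases hab x'
  have h4 := hT.dist_adj_cases hxy a
  have h5 := hT.dist_adj_cases hxy b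
  have h6 := hT.dist_adj_cases hxx b
  have c1 := T.dist_comm (u := a) (v := x)
  have c2 := T.dist_comm (u := a) (v := y)
  have c3 := T.dist_comm (u := b) (v := x)
  have c4 := T.dist_comm (u := b) (v := y)
  have c5 := T.dist_comm (u := b) (v := x')
  have hne : x' ≠ y := by rintro rfl; omega
  -- Both `x'` and `y` are neighbours of `x` one step nearer to `b`.
  obtain ⟨y', hz1, hz2, hz⟩ := hT.quadrangle (r := b) hxx hxy hne (by omega) (by omega)
  have h7 := hT.dist_adj_cases hab y'
  have h8 := hT.dist_adj_cases hz1 a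
  have h9 := hT.dist_adj_cases hz2 a
  have c6 := T.dist_comm (u := a) (v := y')
  have c7 := T.dist_comm (u := a) (v := x')
  refine ⟨x', y', hxx, hz2, hz1, ?_, hne, ?_, ?_, hd⟩
  · rintro rfl; omega
  · simp only [wSet, Set.mem_ofPred_eq]; omega
  · simp only [wSet, Set.mem_ofPred_eq]; omega

/-- A ladder of squares leads from `x y` down to `a b`, and each square preserves both half-spaces.
-/
theorem wSet_eq_of_crossing (hT : T.IsMedian) {a b x y : M} (hab : T.Adj a b) (hxy : T.Adj x y)
    (hx : x ∈ T.wSet a b) (hy : y ∈ T.wSet b a) :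
    T.wSet x y = T.wSet a b ∧ T.wSet y x = T.wSet b a := by
  induction hn : T.dist x a generalizing x y with
  | zero =>
    obtain rfl : x = a := hT.connected.dist_eq_zero_iff.mp hn
    have hy' : T.dist y b < T.dist y x := hy
    rw [T.dist_comm (u := y) (v := x), dist_eq_one_iff_adj.mpr hxy] at hy'
    obtain rfl : y = b := hT.connected.dist_eq_zero_iff.mp (by omega)
    exact ⟨rfl, rfl⟩
  | succ n ih =>
    obtain ⟨x', y', h1, h2, h3, h4, h5, h6, h7, h8⟩ := hT.exists_square hab hxy hx hy (by
      rintro rfl; simp at hn)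
    have := ih h3 h6 h7 (by omega)
    rw [hT.wSet_eq_of_square hxy h1 h2 h3 h4 h5,
      hT.wSet_eq_of_square hxy.symm h2 h1 h3.symm h5.symm h4.symm]
    exact this

end IsMedian

end Median

/-! ### Exchange of vertices along an edge -/

namespace MedianDecomposition

variable {V M : Type*} {G : SimpleGraph V} {T : SimpleGraph M} {D : MedianDecomposition G T}

theorem uSet_congr {a b x y : M} (h : T.wSet x y = T.wSet a b) (h' : T.wSet y x = T.wSet b a) :
    T.uSet x y = T.uSet a b := by
  simp only [uSet, h, h']

theorem zSet_congr {a b x y : M} (h : T.wSet x y = T.wSet a b) (h' : T.wSet y x = T.wSet b a) :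
    D.zSet x y = D.zSet a b := by
  simp only [zSet, uSet_congr h h']

theorem mem_wSet_left {a b : M} (h : T.Adj a b) : a ∈ T.wSet a b := by
  simp [wSet, dist_eq_one_iff_adj.mpr h]

theorem mem_uSet_left {a b : M} (h : T.Adj a b) : a ∈ T.uSet a b :=
  ⟨mem_wSet_left h, b, mem_wSet_left h.symm, h⟩

theorem mem_zSet {a b : M} {v : V} : v ∈ D.zSet a b ↔ ∃ x ∈ T.uSet a b, v ∈ D.bag x := by
  simp [zSet]

theorem bag_subset_zSet {a b : M} (h : T.Adj a b) : D.bag a ⊆ D.zSet a b :=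
  fun _ hv => mem_zSet.mpr ⟨a, mem_uSet_left h, hv⟩

theorem mem_bag_of_mem_zSet {a b : M} (h : T.Adj a b) {v : V} (hv : v ∈ D.bag a)
    (hz : v ∈ D.zSet b a) : v ∈ D.bag b := by
  obtain ⟨x, hx, hvx⟩ := mem_zSet.mp hz
  exact D.convex_bags v a hv x hvx (D.isMedian.mem_geodInterval_of_mem_wSet h hx.1)

theorem bag_diff_subset {a b : M} (h : T.Adj a b) :
    D.bag a \ D.bag b ⊆ D.zSet a b \ D.zSet b a :=
  fun _ hv => ⟨bag_subset_zSet h hv.1, fun hz => hv.2 (mem_bag_of_mem_zSet h hv.1 hz)⟩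

variable (hD : D.IsThetaSmooth)
include hD

/-- Descend the ladder of squares to `a b`. If `va` were lost from `x` to `x'`, then `vb` would be
lost from `y` to `y'`; these edges are opposite, so two vertices would be lost across one class of
edges. -/
theorem IsThetaSmooth.mem_bag_of_crossing {a b : M} (hab : T.Adj a b) {va vb : V}
    (ha : D.zSet a b \ D.zSet b a = {va}) (hb : D.zSet b a \ D.zSet a b = {vb})
    (hc : T.IsGeodConvex (D.support va ∪ D.support vb)) {x y : M} (hxy : T.Adj x y)
    (hx : x ∈ T.wSet a b) (hy : y ∈ T.wSet b a) (hv : va ∈ D.bag x) : va ∈ D.bag a := by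
  have hva : va ∈ D.zSet a b \ D.zSet b a := ha ▸ rfl
  have hvb : vb ∈ D.zSet b a \ D.zSet a b := hb ▸ rfl
  induction hn : T.dist x a generalizing x y with
  | zero =>
    obtain rfl : x = a := D.isMedian.connected.dist_eq_zero_iff.mp hn
    exact hv
  | succ n ih =>
    obtain ⟨x', y', h1, h2, h3, h4, h5, h6, h7, h8⟩ := D.isMedian.exists_square hab hxy hx hy (by
      rintro rfl; simp at hn)
    refine ih h3 h6 h7 ?_ (by omega)
    obtain ⟨w, hw, hvw⟩ := mem_zSet.mp hvb.1
    have hyb : vb ∈ D.bag y := by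
      have hw' : w ∈ T.wSet y x :=
        (D.isMedian.wSet_eq_of_crossing hab hxy hx hy).2 ▸ hw.1
      rcases hc x (Or.inl hv) w (Or.inr hvw)
        (D.isMedian.mem_geodInterval_of_mem_wSet hxy hw') with h | h
      · exact absurd (mem_zSet.mpr ⟨y, ⟨hy, x, hx, hxy.symm⟩, h⟩) hva.2
      · exact h
    have hx'b : vb ∉ D.bag x' := fun h =>
      hvb.2 (mem_zSet.mpr ⟨x', ⟨h6, y', h7, h3⟩, h⟩)
    by_contra hcon
    -- Otherwise `x'`, which lies between `x` and `y'`, would belong to the convex union of the two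
    -- supports.
    have hy'b : vb ∉ D.bag y' := by
      intro h
      have hd : x' ∈ T.geodInterval x y' := by
        refine D.isMedian.mem_geodInterval_of_mem_wSet h1 ?_
        have := D.isMedian.dist_ne_of_adj h1 y'
        have e1 := dist_eq_one_iff_adj.mpr h3.symm
        have e2 : T.dist y' x ≠ 0 := by
          rw [D.isMedian.connected.dist_eq_zero_iff.ne]; exact h4.symm
        simp only [wSet, Set.mem_ofPred_eq]
        omega
      rcases hc x (Or.inl hv) y' (Or.inr h) hd with h | h
      · exact hcon h
      · exact hx'b h
    obtain ⟨p, q, hp, -, -⟩ := hD x x' h1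
    have hvp : va ∈ D.zSet x x' \ D.zSet x' x := bag_diff_subset h1 ⟨hv, hcon⟩
    have hvq : vb ∈ D.zSet x x' \ D.zSet x' x := by
      rw [zSet_congr (D.isMedian.wSet_eq_of_square h1 hxy h3 h2 h4 h5.symm)
          (D.isMedian.wSet_eq_of_square h1.symm h3 hxy h2.symm h5 h4.symm),
        zSet_congr (D.isMedian.wSet_eq_of_square h1.symm h3 hxy h2.symm h5 h4.symm)
          (D.isMedian.wSet_eq_of_square h1 hxy h3 h2 h4 h5.symm)]
      exact bag_diff_subset h2 ⟨hyb, hy'b⟩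
    rw [hp] at hvp hvq
    obtain rfl : va = vb := hvp.trans hvq.symm
    exact hva.2 hvb.1

/-- Along an edge `a b`, exactly one vertex leaves the bag, and it is the one of (M3). -/
theorem IsThetaSmooth.bag_diff {a b : M} (hab : T.Adj a b) :
    D.bag a \ D.bag b = D.zSet a b \ D.zSet b a := by
  refine (bag_diff_subset hab).antisymm ?_
  obtain ⟨va, vb, ha, hb, hc⟩ := hD a b hab
  have hva : va ∈ D.zSet a b \ D.zSet b a := ha ▸ rfl
  obtain ⟨x, ⟨hx, y, hy, hxy⟩, hv⟩ := mem_zSet.mp hva.1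
  rw [ha, Set.singleton_subset_iff]
  exact ⟨hD.mem_bag_of_crossing hab ha hb hc hxy hx hy hv,
    fun h => hva.2 (bag_subset_zSet hab.symm h)⟩

theorem IsThetaSmooth.exists_bag_diff {a b : M} (hab : T.Adj a b) :
    ∃ p, D.bag a \ D.bag b = {p} := by
  obtain ⟨p, q, hp, -, -⟩ := hD a b hab
  exact ⟨p, (hD.bag_diff hab).trans hp⟩

theorem IsThetaSmooth.bag_diff_of_square {x x' y y' : M} (hxy : T.Adj x y)
    (hxx : T.Adj x x') (hyy : T.Adj y y') (hxy' : T.Adj x' y') (hne : x ≠ y') (hne' : x' ≠ y) :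
    D.bag x \ D.bag y = D.bag x' \ D.bag y' := by
  have h1 := D.isMedian.wSet_eq_of_square hxy hxx hyy hxy' hne hne'
  have h2 := D.isMedian.wSet_eq_of_square hxy.symm hyy hxx hxy'.symm hne'.symm hne.symm
  rw [hD.bag_diff hxy, hD.bag_diff hxy', zSet_congr h1 h2, zSet_congr h2 h1]

end MedianDecomposition
-- The colouring by the root bag
namespace MedianDecomposition

variable {V M : Type*} {G : SimpleGraph V} {T : SimpleGraph M} {D : MedianDecomposition G T}

/-- If `a` is not the vertex of `X⁻¹(p)` closest to `r`, one can step from `a` towards `r` without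
leaving `X⁻¹(p)`. -/
theorem exists_adj_mem_bag {a w r : M} {p : V} (ha : p ∈ D.bag a) (hw : p ∈ D.bag w)
    (hne : a ≠ w) (hd : T.dist w r ≤ T.dist a r) :
    ∃ b, T.Adj a b ∧ p ∈ D.bag b ∧ T.dist b r + 1 = T.dist a r := by
  have hT := D.isMedian
  obtain ⟨m, h1, h2, h3⟩ := hT.exists_median a w r
  have hm : p ∈ D.bag m := D.convex_bags p a ha w hw h1
  have c1 := T.dist_comm (u := a) (v := r)
  have c2 := T.dist_comm (u := a) (v := m)
  have c3 := T.dist_comm (u := m) (v := r)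
  have c4 := T.dist_comm (u := m) (v := w)
  have ham : a ≠ m := by
    rintro rfl
    have : T.dist a w ≠ 0 := by rw [hT.connected.dist_eq_zero_iff.ne]; exact hne
    have c5 := T.dist_comm (u := a) (v := w)
    omega
  obtain ⟨b, hab, hb⟩ := hT.exists_adj_dist_add_one ham
  have hb1 := dist_eq_one_iff_adj.mpr hab
  have h4 := hT.connected.dist_triangle (u := b) (v := m) (w := r)
  have h5 := hT.dist_adj_cases hab r
  have c6 := T.dist_comm (u := b) (v := r)
  refine ⟨b, hab, D.convex_bags p a ha m hm ?_, by omega⟩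
  rw [mem_geodInterval]
  omega

/-- The data of the step from the gate of `X⁻¹(p)` towards `r`: at the edge `g b`, the vertex `p`
is exchanged for `q`. -/
def IsExchange (D : MedianDecomposition G T) (r : M) (p q : V) : Prop :=
  ∃ g b, T.Adj g b ∧ T.dist b r + 1 = T.dist g r ∧ p ∈ D.bag g ∧
    (∀ w, p ∈ D.bag w → T.dist g r ≤ T.dist w r) ∧ p ∉ D.bag b ∧ q ∈ D.bag b ∧ q ∉ D.bag g

theorem exists_closest (D : MedianDecomposition G T) (r : M) (p : V) :
    ∃ g, p ∈ D.bag g ∧ ∀ w, p ∈ D.bag w → T.dist g r ≤ T.dist w r := by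
  obtain ⟨g, hg, h⟩ := exists_minimal_of_wellFoundedLT (fun n => ∃ g, p ∈ D.bag g ∧ T.dist g r = n)
    (let ⟨a, ha⟩ := D.exists_bag p; ⟨_, a, ha, rfl⟩)
  obtain ⟨g, hg, rfl⟩ := hg
  refine ⟨g, hg, fun w hw => ?_⟩
  by_contra hlt
  exact hlt (h ⟨w, hw, rfl⟩ (by omega))

theorem IsThetaSmooth.exists_isExchange (hD : D.IsThetaSmooth) {r : M} {p : V}
    (hp : p ∉ D.bag r) : ∃ q, D.IsExchange r p q := by
  obtain ⟨g, hg, hmin⟩ := D.exists_closest r p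
  have hgr : g ≠ r := by rintro rfl; exact hp hg
  obtain ⟨b, hgb, hb⟩ := D.isMedian.exists_adj_dist_add_one hgr
  obtain ⟨q, hq⟩ := hD.exists_bag_diff hgb.symm
  have hq' : q ∈ D.bag b \ D.bag g := hq ▸ rfl
  refine ⟨q, g, b, hgb, hb, hg, hmin, fun h => ?_, hq'.1, hq'.2⟩
  have := hmin b h
  omega

/-- A map that is the identity on `X_r` and constant along exchanges at gates is constant along the
exchanges at all edges. -/
theorem IsThetaSmooth.eq_of_exchange (hD : D.IsThetaSmooth) {r : M} {α : Type*} {c : V → α}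
    (hc : ∀ p, p ∉ D.bag r → ∃ q, D.IsExchange r p q ∧ c p = c q) {a b : M} (hab : T.Adj a b)
    (hb : T.dist b r + 1 = T.dist a r) {p q : V} (hpa : p ∈ D.bag a) (hpb : p ∉ D.bag b)
    (hqb : q ∈ D.bag b) (hqa : q ∉ D.bag a) : c p = c q := by
  have hT := D.isMedian
  induction hn : T.dist a r using Nat.strong_induction_on generalizing a b with
  | _ n ih =>
  -- If `p` survives a step to `b'`, the square on `b` and `b'` moves the exchange to an edge nearer
  -- to `r`.
  have key : ∀ b', T.Adj a b' → p ∈ D.bag b' → T.dist b' r + 1 = T.dist a r → ∃ z, T.Adj b' z ∧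
      T.dist z r + 1 = T.dist b' r ∧ D.bag a \ D.bag b = D.bag b' \ D.bag z ∧
      D.bag b \ D.bag a = D.bag z \ D.bag b' := by
    intro b' hab' hpb' hb'
    have hne : b' ≠ b := by rintro rfl; exact hpb hpb'
    obtain ⟨z, h1, h2, h3⟩ := hT.quadrangle hab' hab hne hb' hb
    have haz : a ≠ z := by rintro rfl; omega
    exact ⟨z, h1, by omega, hD.bag_diff_of_square hab hab' h2 h1 haz hne,
      hD.bag_diff_of_square hab.symm h2 hab' h1.symm hne.symm haz.symm⟩
  by_cases hex : ∃ b', T.Adj a b' ∧ p ∈ D.bag b' ∧ T.dist b' r + 1 = T.dist a r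
  · obtain ⟨b', hab', hpb', hb'⟩ := hex
    obtain ⟨z, h1, h2, h3, h4⟩ := key b' hab' hpb' hb'
    have hp : p ∈ D.bag b' \ D.bag z := h3 ▸ ⟨hpa, hpb⟩
    have hq : q ∈ D.bag z \ D.bag b' := h4 ▸ ⟨hqb, hqa⟩
    exact ih (T.dist b' r) (by omega) h1 h2 hp.1 hp.2 hq.1 hq.2 rfl
  · have hpr : p ∉ D.bag r := by
      intro h
      refine hex (exists_adj_mem_bag hpa h ?_ (by simp))
      rintro rfl; simp at hb
    obtain ⟨q', ⟨g, b', hgb, hb', hg, hmin, hpb', hqb', hqg⟩, hcq⟩ := hc p hpr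
    -- Since `p` survives no step towards `r`, `a` is the gate. A second step from it would span a
    -- square in which `p` is kept on the far side, so the exchanges agree.
    obtain rfl : a = g := by
      by_contra hne
      exact hex (exists_adj_mem_bag hpa hg hne (hmin a hpa))
    rw [hcq]
    congr 1
    obtain ⟨s, hs⟩ := hD.exists_bag_diff hab.symm
    have hqs : q ∈ ({s} : Set V) := hs ▸ ⟨hqb, hqa⟩
    by_cases hbb : b = b'
    · subst hbb
      have hqs' : q' ∈ ({s} : Set V) := hs ▸ ⟨hqb', hqg⟩
      exact hqs'.trans hqs.symm
    · exfalso
      obtain ⟨z, h1, h2, h3⟩ := hT.quadrangle hab hgb hbb hb hb'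
      have haz : a ≠ z := by rintro rfl; omega
      have h4 := hD.bag_diff_of_square hab hgb h1 h2 haz (Ne.symm hbb)
      have h5 : p ∈ D.bag b' \ D.bag z := h4 ▸ ⟨hpa, hpb⟩
      exact hpb' h5.1

/-- Moving away from `r` replaces `q` by a vertex `p` of the same colour, so injectivity persists.
-/
theorem IsThetaSmooth.injOn_bag (hD : D.IsThetaSmooth) {r : M} {α : Type*} {c : V → α}
    (hc : ∀ p, p ∉ D.bag r → ∃ q, D.IsExchange r p q ∧ c p = c q)
    (hr : Set.InjOn c (D.bag r)) (a : M) : Set.InjOn c (D.bag a) := by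
  have hT := D.isMedian
  induction hn : T.dist a r generalizing a with
  | zero =>
    obtain rfl : a = r := hT.connected.dist_eq_zero_iff.mp hn
    exact hr
  | succ n ih =>
    obtain ⟨b, hab, hb⟩ := hT.exists_adj_dist_add_one (a := a) (w := r) (by
      rintro rfl; simp at hn)
    have hinj := ih b (by omega)
    obtain ⟨p, hp⟩ := hD.exists_bag_diff hab
    obtain ⟨q, hq⟩ := hD.exists_bag_diff hab.symm
    have hp' : p ∈ D.bag a \ D.bag b := hp ▸ rfl
    have hq' : q ∈ D.bag b \ D.bag a := hq ▸ rfl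
    have hpq := hD.eq_of_exchange hc hab hb hp'.1 hp'.2 hq'.1 hq'.2
    have hmem : ∀ u ∈ D.bag a, u = p ∨ u ∈ D.bag b := by
      intro u hu
      by_cases h : u ∈ D.bag b
      · exact Or.inr h
      · have : u ∈ ({p} : Set V) := hp ▸ ⟨hu, h⟩
        exact Or.inl this
    intro u hu v hv huv
    rcases hmem u hu with rfl | hub <;> rcases hmem v hv with rfl | hvb
    · rfl
    · rw [hpq] at huv
      exact absurd (hinj hq'.1 hvb huv ▸ hv) hq'.2
    · rw [hpq] at huv
      exact absurd (hinj hub hq'.1 huv ▸ hu) hq'.2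
    · exact hinj hub hvb huv

/-- Iterate the replacement map: each step brings the closest bag strictly nearer to `r`, and
vertices of `X_r` are fixed, so one number of steps serves all vertices. -/
theorem IsThetaSmooth.exists_root_map [Finite M] (hD : D.IsThetaSmooth) (r : M) :
    ∃ c : V → V, (∀ v, c v ∈ D.bag r) ∧ (∀ v ∈ D.bag r, c v = v) ∧
      ∀ p, p ∉ D.bag r → ∃ q, D.IsExchange r p q ∧ c p = c q := by
  classical
  choose! f hf using fun p (hp : p ∉ D.bag r) => hD.exists_isExchange hp
  choose g hg hmin using D.exists_closest r
  let F : V → V := fun p => if p ∈ D.bag r then p else f p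
  have hFr : ∀ p ∈ D.bag r, F p = p := fun p hp => if_pos hp
  obtain ⟨N, hN⟩ := (Set.finite_range fun a => T.dist a r).bddAbove
  have hlt : ∀ p, p ∉ D.bag r → T.dist (g (F p)) r < T.dist (g p) r := by
    intro p hp
    obtain ⟨a, b, -, h1, -, h2, -, h3, -⟩ := hf p hp
    have h4 := h2 _ (hg p)
    have h5 := hmin (f p) b h3
    simp only [F, if_neg hp]
    omega
  have hiter : ∀ n p, T.dist (g p) r ≤ n → F^[n] p ∈ D.bag r := by
    intro n
    induction n with
    | zero =>
      intro p hp
      have : g p = r := D.isMedian.connected.dist_eq_zero_iff.mp (by omega)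
      exact this ▸ hg p
    | succ n ih =>
      intro p hp
      rw [Function.iterate_succ_apply]
      refine ih _ ?_
      by_cases h : p ∈ D.bag r
      · have := hmin p r h
        rw [hFr p h]
        simp only [dist_self] at this
        omega
      · have := hlt p h
        omega
  have hall : ∀ p, F^[N] p ∈ D.bag r := fun p => hiter N p (hN ⟨_, rfl⟩)
  refine ⟨F^[N], hall, fun v hv => Function.iterate_fixed (hFr v hv) N, fun p hp =>
    ⟨f p, hf p hp, ?_⟩⟩
  have h1 : F p = f p := if_neg hp
  rw [← h1, ← Function.iterate_succ_apply, Function.iterate_succ_apply', hFr _ (hall p)]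

/-- A graph with a `Θ`-smooth median decomposition can be coloured with as many colours as the
width. -/
theorem IsThetaSmooth.colorable_width [Fintype M] [Finite V] (hD : D.IsThetaSmooth) :
    G.Colorable D.width := by
  obtain ⟨r⟩ := D.isMedian.connected.nonempty
  obtain ⟨c, hcr, hfix, hc⟩ := hD.exists_root_map r
  have hinj := hD.injOn_bag hc (fun u hu v hv huv => by rwa [hfix u hu, hfix v hv] at huv)
  let C : G.Coloring (D.bag r) := Coloring.mk (fun v => ⟨c v, hcr v⟩) fun {u v} huv heq => by
    obtain ⟨a, hu, hv⟩ := D.exists_bag_of_adj u v huv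
    exact huv.ne (hinj a hu hv (congrArg Subtype.val heq))
  have := Fintype.ofFinite (D.bag r)
  refine C.colorable.mono ?_
  rw [← Nat.card_eq_fintype_card, Nat.card_coe_set_eq]
  exact Finset.le_sup (f := fun a => (D.bag a).ncard) (Finset.mem_univ r)

end MedianDecomposition

/-! ### Products of paths -/

section Grid

variable {ι : Type*} {n : ι → ℕ}

/-- The Cartesian product of the paths on `n i` vertices. -/
def grid (n : ι → ℕ) : SimpleGraph (∀ i, Fin (n i)) where
  Adj f g := ∃ i, Nat.dist (f i) (g i) = 1 ∧ ∀ j, j ≠ i → f j = g j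
  symm := ⟨fun _ _ ⟨i, h, h'⟩ => ⟨i, by rw [Nat.dist_comm, h], fun j hj => (h' j hj).symm⟩⟩
  loopless := ⟨fun f ⟨i, h, _⟩ => by simp at h⟩

variable [Fintype ι]

theorem sum_dist_of_eq_off {f f' : ∀ i, Fin (n i)} {i : ι} (h : ∀ j, j ≠ i → f j = f' j)
    (g : ∀ i, Fin (n i)) :
    ∑ j, Nat.dist (f j) (g j) + Nat.dist (f' i) (g i) =
      ∑ j, Nat.dist (f' j) (g j) + Nat.dist (f i) (g i) := by
  classical
  rw [← Finset.add_sum_erase _ _ (Finset.mem_univ i),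
    ← Finset.add_sum_erase _ (fun j => Nat.dist (f' j) (g j)) (Finset.mem_univ i)]
  have : ∑ j ∈ Finset.univ.erase i, Nat.dist (f j) (g j) =
      ∑ j ∈ Finset.univ.erase i, Nat.dist (f' j) (g j) :=
    Finset.sum_congr rfl fun j hj => by rw [h j (Finset.ne_of_mem_erase hj)]
  rw [this]
  ring

theorem exists_grid_walk (f g : ∀ i, Fin (n i)) :
    ∃ p : (grid n).Walk f g, p.length = ∑ i, Nat.dist (f i) (g i) := by
  classical
  induction hm : ∑ i, Nat.dist (f i) (g i) generalizing f with
  | zero =>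
    rw [Finset.sum_eq_zero_iff] at hm
    obtain rfl : f = g := funext fun i => Fin.ext (Nat.eq_of_dist_eq_zero (hm i (Finset.mem_univ i)))
    exact ⟨.nil, rfl⟩
  | succ m ih =>
    obtain ⟨i, -, hi⟩ := Finset.exists_ne_zero_of_sum_ne_zero (by rw [hm]; omega :
      ∑ i, Nat.dist (f i) (g i) ≠ 0)
    obtain ⟨x, hx1, hx2⟩ : ∃ x : Fin (n i), Nat.dist (f i) x = 1 ∧
        Nat.dist x (g i) + 1 = Nat.dist (f i) (g i) := by
      have h1 := (f i).2
      have h2 := (g i).2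
      simp only [Nat.dist] at hi ⊢
      rcases lt_or_ge (f i : ℕ) (g i) with h | h
      · exact ⟨⟨f i + 1, by omega⟩, by simp only; omega, by simp only; omega⟩
      · exact ⟨⟨f i - 1, by omega⟩, by simp only; omega, by simp only; omega⟩
    have hoff : ∀ j, j ≠ i → f j = Function.update f i x j := fun j hj => by simp [hj]
    have hs := sum_dist_of_eq_off hoff g
    rw [Function.update_self] at hs
    obtain ⟨p, hp⟩ := ih (Function.update f i x) (by omega)
    have hadj : (grid n).Adj f (Function.update f i x) :=
      ⟨i, by rw [Function.update_self, hx1], hoff⟩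
    exact ⟨.cons hadj p, by rw [Walk.length_cons, hp]⟩

theorem sum_dist_le_length {f g : ∀ i, Fin (n i)} (p : (grid n).Walk f g) :
    ∑ i, Nat.dist (f i) (g i) ≤ p.length := by
  induction p with
  | nil => simp
  | @cons u v w h q ih =>
    obtain ⟨i, hi, hoff⟩ := id h
    have h1 := sum_dist_of_eq_off hoff w
    have h2 := Nat.dist.triangle_inequality (u i) (v i) (w i)
    simp only [Walk.length_cons]
    omega

theorem grid_preconnected : (grid n).Preconnected := fun f g =>
  ⟨(exists_grid_walk f g).choose⟩

theorem grid_dist (f g : ∀ i, Fin (n i)) :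
    (grid n).dist f g = ∑ i, Nat.dist (f i) (g i) := by
  apply le_antisymm
  · obtain ⟨p, hp⟩ := exists_grid_walk f g
    exact hp ▸ dist_le p
  · obtain ⟨p, hp⟩ := (grid_preconnected f g).exists_walk_length_eq_dist
    exact hp ▸ sum_dist_le_length p

/-- Distances add over coordinates, so equality in the triangle inequality holds coordinatewise and
intervals are boxes. -/
theorem mem_geodInterval_grid {f g x : ∀ i, Fin (n i)} :
    x ∈ (grid n).geodInterval f g ↔
      ∀ i, ((f i : ℕ) ≤ x i ∧ (x i : ℕ) ≤ g i) ∨ ((g i : ℕ) ≤ x i ∧ (x i : ℕ) ≤ f i) := by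
  rw [mem_geodInterval, grid_dist, grid_dist, grid_dist, ← Finset.sum_add_distrib,
    Finset.sum_eq_sum_iff_of_le fun i _ => Nat.dist.triangle_inequality _ _ _]
  refine ⟨fun h i => ?_, fun h i _ => ?_⟩
  · have := h i (Finset.mem_univ i)
    simp only [Nat.dist] at this
    omega
  · have := h i
    simp only [Nat.dist]
    omega

theorem isMedian_grid (hn : ∀ i, 0 < n i) : (grid n).IsMedian where
  connected := { preconnected := grid_preconnected, nonempty := ⟨fun i => ⟨0, hn i⟩⟩ }
  existsUnique_median u v w := by
    -- The coordinatewise middle value.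
    refine ⟨fun i => max (min (u i) (v i)) (max (min (v i) (w i)) (min (w i) (u i))), ?_, ?_⟩
    · simp only [Set.mem_inter_iff, mem_geodInterval_grid, Fin.coe_max, Fin.coe_min]
      refine ⟨⟨fun i => ?_, fun i => ?_⟩, fun i => ?_⟩ <;> omega
    · intro y hy
      simp only [Set.mem_inter_iff, mem_geodInterval_grid] at hy
      funext i
      have h1 := hy.1.1 i
      have h2 := hy.1.2 i
      have h3 := hy.2 i
      ext
      simp only [Fin.coe_max, Fin.coe_min]
      omega

theorem mem_wSet_grid {a b f : ∀ i, Fin (n i)} {i : ι} (hoff : ∀ j, j ≠ i → a j = b j) :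
    f ∈ (grid n).wSet a b ↔ Nat.dist (f i) (a i) < Nat.dist (f i) (b i) := by
  have h := sum_dist_of_eq_off hoff f
  simp only [Nat.dist_comm _ (f _ : ℕ)] at h
  change (grid n).dist f a < (grid n).dist f b ↔ _
  rw [grid_dist, grid_dist]
  omega

/-- The half-spaces are cut between the consecutive values `a i` and `b i`, so only one layer
touches the other side. -/
theorem mem_uSet_grid {a b f : ∀ i, Fin (n i)} {i : ι} (hi : Nat.dist (a i) (b i) = 1)
    (hoff : ∀ j, j ≠ i → a j = b j) : f ∈ (grid n).uSet a b ↔ f i = a i := by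
  classical
  change (f ∈ (grid n).wSet a b ∧ ∃ w ∈ (grid n).wSet b a, (grid n).Adj f w) ↔ _
  simp only [mem_wSet_grid hoff, mem_wSet_grid fun j hj => (hoff j hj).symm]
  constructor
  · rintro ⟨h1, g, h2, l, h3, h4⟩
    have h5 : Nat.dist (f i) (g i) ≤ 1 := by
      by_cases hl : i = l
      · subst hl; exact h3.le
      · rw [h4 i hl]; simp
    ext
    simp only [Nat.dist] at *
    omega
  · intro h
    refine ⟨by rw [h, hi]; simp, Function.update f i (b i), ?_, i, ?_, fun j hj => by simp [hj]⟩
    · rw [Function.update_self, Nat.dist_comm (b i) (a i), hi]; simp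
    · rw [Function.update_self, h, hi]

end Grid

/-! ### The decomposition of a coloured graph -/

/-- For a surjective colouring with finite colour classes, enumerated by `e`, the decomposition
over a grid whose bags are the transversals of the colour classes. -/
def gridDecomposition {V ι : Type*} {G : SimpleGraph V} [Fintype ι] (C : G.Coloring ι) {n : ι → ℕ}
    (hn : ∀ i, 0 < n i) (e : ∀ v, Fin (n (C v))) : MedianDecomposition G (grid n) where
  isMedian := isMedian_grid hn
  bag f := {v | f (C v) = e v}
  exists_bag_of_adj u v huv := by
    classical
    have hne := C.valid huv
    let f : ∀ i, Fin (n i) := fun i => ⟨0, hn i⟩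
    refine ⟨Function.update (Function.update f (C u) (e u)) (C v) (e v), ?_, ?_⟩
    · simp [hne]
    · simp
  exists_bag v := by
    classical
    let f : ∀ i, Fin (n i) := fun i => ⟨0, hn i⟩
    exact ⟨Function.update f (C v) (e v), by simp⟩
  convex_bags v f hf g hg x hx := by
    have h1 : f (C v) = e v := hf
    have h2 : g (C v) = e v := hg
    have h3 := mem_geodInterval_grid.mp hx (C v)
    rw [h1, h2] at h3
    change x (C v) = e v
    ext
    omega

/-- A layer fixes only coordinate `i`, so its bags contain all vertices of the other classes. -/
theorem mem_zSet_gridDecomposition {V ι : Type*} {G : SimpleGraph V} [Fintype ι]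
    {C : G.Coloring ι} {n : ι → ℕ} (hn : ∀ i, 0 < n i) (e : ∀ v, Fin (n (C v)))
    {a b : ∀ i, Fin (n i)} {i : ι} (hi : Nat.dist (a i) (b i) = 1)
    (hoff : ∀ j, j ≠ i → a j = b j) {v : V} :
    v ∈ (gridDecomposition C hn e).zSet a b ↔ (C v = i → a (C v) = e v) := by
  classical
  rw [MedianDecomposition.mem_zSet]
  simp only [mem_uSet_grid hi hoff]
  constructor
  · rintro ⟨f, hf, hv⟩ rfl
    exact hf.symm.trans hv
  · intro h
    by_cases hv : C v = i
    · exact ⟨a, rfl, h hv⟩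
    · refine ⟨Function.update a (C v) (e v), ?_, ?_⟩
      · rw [Function.update_of_ne (Ne.symm hv)]
      · change Function.update a (C v) (e v) (C v) = e v
        simp

/-- The exchanged vertices are consecutive in their class, so their supports are adjacent layers
with convex union. Positions are compared in `ℕ` because `e u` and `e v` have different types. -/
theorem isThetaSmooth_gridDecomposition {V ι : Type*} {G : SimpleGraph V} [Fintype ι]
    {C : G.Coloring ι} {n : ι → ℕ} (hn : ∀ i, 0 < n i) (e : ∀ v, Fin (n (C v)))
    (he : ∀ i (x : Fin (n i)), ∃ v, C v = i ∧ (e v : ℕ) = x)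
    (hinj : ∀ u v, C u = C v → (e u : ℕ) = e v → u = v) :
    (gridDecomposition C hn e).IsThetaSmooth := by
  rintro a b ⟨i, hi, hoff⟩
  have hoff' : ∀ j, j ≠ i → b j = a j := fun j hj => (hoff j hj).symm
  have hi' : Nat.dist (b i) (a i) = 1 := by rw [Nat.dist_comm, hi]
  have hab : (a i : ℕ) ≠ b i := by
    intro h
    simp [h] at hi
  obtain ⟨va, rfl, hva⟩ := he i (a i)
  obtain ⟨vb, hCb, hvb⟩ := he _ (b (C va))
  have hvb' : (e vb : ℕ) = b (C vb) := by rw [hvb, hCb]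
  refine ⟨va, vb, ?_, ?_, ?_⟩
  · ext v
    simp only [Set.mem_sdiff, mem_zSet_gridDecomposition hn e hi hoff,
      mem_zSet_gridDecomposition hn e hi' hoff', Set.mem_singleton_iff, Classical.not_imp]
    constructor
    · rintro ⟨h1, h2, -⟩
      refine hinj v va h2 ?_
      rw [hva, ← h1 h2, h2]
    · rintro rfl
      refine ⟨fun _ => Fin.ext hva.symm, rfl, fun h => hab ?_⟩
      rw [← hva, h]
  · ext v
    simp only [Set.mem_sdiff, mem_zSet_gridDecomposition hn e hi hoff,
      mem_zSet_gridDecomposition hn e hi' hoff', Set.mem_singleton_iff, Classical.not_imp]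
    constructor
    · rintro ⟨h1, h2, -⟩
      refine hinj v vb (h2.trans hCb.symm) ?_
      rw [hvb, ← h1 h2, h2]
    · rintro rfl
      refine ⟨fun _ => Fin.ext hvb'.symm, hCb, fun h => hab ?_⟩
      rw [← hvb, ← h, hCb]
  · have hsupp : ∀ f, f ∈ (gridDecomposition C hn e).support va ∪
        (gridDecomposition C hn e).support vb ↔
        (f (C va) : ℕ) = a (C va) ∨ (f (C va) : ℕ) = b (C va) := by
      intro f
      change (f (C va) = e va ∨ f (C vb) = e vb) ↔ _
      rw [Fin.ext_iff, Fin.ext_iff, hva, hvb, hCb]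
    intro f hf g hg x hx
    rw [hsupp] at hf hg ⊢
    have := mem_geodInterval_grid.mp hx (C va)
    simp only [Nat.dist] at hi
    omega

theorem width_gridDecomposition_le {V : Type*} {G : SimpleGraph V} [Finite V] {k : ℕ}
    {C : G.Coloring (Fin k)} {n : Fin k → ℕ} (hn : ∀ i, 0 < n i) (e : ∀ v, Fin (n (C v)))
    (hinj : ∀ u v, C u = C v → (e u : ℕ) = e v → u = v) :
    (gridDecomposition C hn e).width ≤ k := by
  refine Finset.sup_le fun f _ => ?_
  have h : Set.InjOn C ((gridDecomposition C hn e).bag f) := by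
    intro u hu v hv huv
    have h1 : f (C u) = e u := hu
    have h2 : f (C v) = e v := hv
    exact hinj u v huv (by rw [← h1, ← h2, huv])
  calc _ = (C '' (gridDecomposition C hn e).bag f).ncard := h.ncard_image.symm
    _ ≤ (Set.univ : Set (Fin k)).ncard := Set.ncard_le_ncard (Set.subset_univ _)
    _ = k := by simp

theorem exists_isThetaSmooth_width_le {V : Type*} [Finite V] {G : SimpleGraph V} {k : ℕ}
    (C : G.Coloring (Fin k)) (hC : Function.Surjective C) :
    ∃ (M : Type) (_ : Fintype M) (T : SimpleGraph M) (D : MedianDecomposition G T),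
      D.IsThetaSmooth ∧ D.width ≤ k := by
  let n : Fin k → ℕ := fun i => Nat.card {v // C v = i}
  let E : ∀ i, {v // C v = i} ≃ Fin (n i) := fun i => Finite.equivFin _
  -- Surjectivity of the colouring enters here: an empty class would make the grid empty.
  have hn : ∀ i, 0 < n i := fun i =>
    have : Nonempty {v // C v = i} := let ⟨v, hv⟩ := hC i; ⟨⟨v, hv⟩⟩
    Nat.card_pos
  let e : ∀ v, Fin (n (C v)) := fun v => E (C v) ⟨v, rfl⟩
  have hE : ∀ i (v : {v // C v = i}), (e v : ℕ) = E i v := by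
    rintro _ ⟨v, rfl⟩
    rfl
  have hinj : ∀ u v, C u = C v → (e u : ℕ) = e v → u = v := by
    intro u v h1 h2
    rw [hE (C v) ⟨u, h1⟩, hE (C v) ⟨v, rfl⟩] at h2
    exact congrArg Subtype.val ((E (C v)).injective (Fin.ext h2))
  refine ⟨∀ i, Fin (n i), inferInstance, grid n, gridDecomposition C hn e,
    isThetaSmooth_gridDecomposition hn e (fun i x => ?_) hinj,
    width_gridDecomposition_le hn e hinj⟩
  exact ⟨(E i).symm x, ((E i).symm x).2, by rw [hE i, Equiv.apply_symm_apply]⟩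

/-! ### Equality with the chromatic number -/

theorem chromaticNumber_mem_smoothWidths {V : Type*} [Finite V] (G : SimpleGraph V) :
    G.chromaticNumber ∈ G.smoothWidths := by
  have hcol := G.colorable_chromaticNumber_of_fintype
  obtain ⟨k, hk⟩ : ∃ k : ℕ, G.chromaticNumber = k :=
    ⟨_, (ENat.natCast_toNat (chromaticNumber_ne_top_iff_exists.mpr ⟨_, hcol⟩)).symm⟩
  obtain ⟨C⟩ := chromaticNumber_le_iff_colorable.mp hk.le
  obtain ⟨M, hM, T, D, hD, hw⟩ := exists_isThetaSmooth_width_le C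
    -- An optimal colouring uses every colour.
    (le_chromaticNumber_iff_forall_surjective.mp hk.ge C)
  refine ⟨M, hM, T, D, hD, le_antisymm ?_ hD.colorable_width.chromaticNumber_le⟩
  rw [hk]
  exact_mod_cast hw

theorem smoothMedianwidth_eq_chromaticNumber {V : Type*} [Finite V] (G : SimpleGraph V) :
    G.smoothMedianwidth = G.chromaticNumber := by
  refine le_antisymm (sInf_le G.chromaticNumber_mem_smoothWidths) (le_sInf ?_)
  rintro _ ⟨M, hM, T, D, hD, rfl⟩
  exact hD.colorable_width.chromaticNumber_le

end SimpleGraph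

/-- The smooth medianwidth of a finite graph is attained as a minimum, and it equals the
chromatic number. -/
theorem mainTheorem2 {V : Type*} [Finite V] (G : SimpleGraph V) :
    G.smoothMedianwidth ∈ G.smoothWidths ∧ G.smoothMedianwidth = G.chromaticNumber := by
  have h := G.smoothMedianwidth_eq_chromaticNumber
  exact ⟨h ▸ G.chromaticNumber_mem_smoothWidths, h⟩
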